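/- For $n\ge 1$, a partial Latin square of order $n$ is a non-empty set $P$ of triples (row, column, symbol) over an $n$-element set in which any two coordinates of a triple determine the third; it is a Latin square if $|P|=n^2$. Two partial Latin squares $P,Q$ of order $n$ are orthogonal if they have the same non-empty cells and there are no two distinct cells that contain equal symbols in $P$ and also equal symbols in $Q$. A set of $t$ MOLS of order $m$ is a set of $t$ pairwise orthogonal Latin squares of order $m$. A pair $(P,Q)$ of orthogonal partial Latin squares embeds in such a set if there are two different squares $L,M$ in the set and injective maps $f_1$ (rows), $f_2$ (columns), $f_3,g_3$ (symbols) such that $(f_1(r),f_2(c),f_3(e))\in L$ for all $(r,c,e)\in P$ and $(f_1(r),f_2(c),g_3(e))\in M$ for all $(r,c,e)\in Q$. Let $t\ge 2$. (1) There are a polynomial $p$ and a function $N:\mathbb{N}\to\mathbb{N}$ with $N(n)\le p(n)$ for all $n$, both depending only on $t$, such that for every $n\ge 1$ every pair of orthogonal partial Latin squares of order $n$ embeds in a set of $t$ MOLS of order $N(n)$. (2) If $n\ge1$ and $k$ is the power of $2$ with $k\ge 2n>k/2$, and if $t\le k^4+1$, then every pair of orthogonal partial Latin squares of order $n$ embeds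 in a set of $t$ MOLS of order $k^8$. -/

import Mathlib

/-- A partial Latin square of order `n`: a non-empty set of triples (row, column, symbol) in which
any two of the three coordinates of a triple determine the third. -/
def IsPLS {n : ℕ} (P : Set (Fin n × Fin n × Fin n)) : Prop :=
  P.Nonempty ∧
  ∀ r c e r' c' e' : Fin n, (r, c, e) ∈ P → (r', c', e') ∈ P →
    (r = r' → c = c' → e = e') ∧ (r = r' → e = e' → c = c') ∧ (c = c' → e = e' → r = r')

/-- A Latin square of order `n`: a partial Latin square of volume `n ^ 2`. -/
def IsLatinSquare {n : ℕ} (L : Set (Fin n × Fin n × Fin n)) : Prop :=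
  IsPLS L ∧ L.ncard = n ^ 2

/-- Orthogonality of two partial Latin squares of the same order: they have the same non-empty
cells, and no two distinct cells carry equal symbols in the first and also in the second. -/
def IsOrthogonal {n : ℕ} (P Q : Set (Fin n × Fin n × Fin n)) : Prop :=
  (∀ r c : Fin n, (∃ e, (r, c, e) ∈ P) ↔ (∃ e, (r, c, e) ∈ Q)) ∧
  ∀ r₁ c₁ r₂ c₂ x y : Fin n, (r₁, c₁) ≠ (r₂, c₂) →
    (r₁, c₁, x) ∈ P → (r₂, c₂, x) ∈ P → ¬ ((r₁, c₁, y) ∈ Q ∧ (r₂, c₂, y) ∈ Q)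

/-- A pair of orthogonal partial Latin squares of order `n`. -/
def IsOPLS {n : ℕ} (P Q : Set (Fin n × Fin n × Fin n)) : Prop :=
  IsPLS P ∧ IsPLS Q ∧ IsOrthogonal P Q

/-- A set of `t` mutually orthogonal Latin squares of order `m`, listed without repetition. -/
def IsMOLS {m t : ℕ} (L : Fin t → Set (Fin m × Fin m × Fin m)) : Prop :=
  Function.Injective L ∧ (∀ i, IsLatinSquare (L i)) ∧
    ∀ i j, i ≠ j → IsOrthogonal (L i) (L j)

/-- The injections `f₁`, `f₂`, `f₃` of rows, columns and symbols embed `P` in `L`. -/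
def IsEmbedding {n m : ℕ} (f₁ f₂ f₃ : Fin n → Fin m)
    (P : Set (Fin n × Fin n × Fin n)) (L : Set (Fin m × Fin m × Fin m)) : Prop :=
  Function.Injective f₁ ∧ Function.Injective f₂ ∧ Function.Injective f₃ ∧
    ∀ r c e : Fin n, (r, c, e) ∈ P → (f₁ r, f₂ c, f₃ e) ∈ L

/-- The pair `(P, Q)` embeds in the pair `(L, M)`: rows and columns are mapped in the same way for
both squares, so that superimposed cells stay superimposed; the symbols of `P` and of `Q` are
mapped separately. -/
def PairEmbeds {n m : ℕ} (P Q : Set (Fin n × Fin n × Fin n))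
    (L M : Set (Fin m × Fin m × Fin m)) : Prop :=
  ∃ f₁ f₂ f₃ g₃ : Fin n → Fin m, IsEmbedding f₁ f₂ f₃ P L ∧ IsEmbedding f₁ f₂ g₃ Q M

/-- The pair `(P, Q)` embeds in some set of `t` MOLS of order `m`: two different squares of the
set contain copies of `P` and `Q`. -/
def EmbedsInMOLS {n : ℕ} (P Q : Set (Fin n × Fin n × Fin n)) (t m : ℕ) : Prop :=
  ∃ L : Fin t → Set (Fin m × Fin m × Fin m), IsMOLS L ∧
    ∃ i j : Fin t, i ≠ j ∧ PairEmbeds P Q (L i) (L j)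

/-! Superimposing `P` and `Q` turns filled cells into words of length four, any two agreeing in at
most one coordinate. Such words embed in an orthogonal array with `q = 16 ^ (a + 1)` symbols once `n
≤ 2 ^ a` (`exists_separating_of_words`): a linear array over `𝔽₄` is altered so that it contains
them. A word's cell is chosen so that columns 0 and 1 are right; columns 2 and 3 are corrected by
constants on a small block of translates. For any two columns, the correction acts as a permutation
of the cells (`exists_separating_correction`), so separation survives if the blocks are disjoint. A
control position and the sparse agreement of words ensure this. The product of this array with a
column-permuted copy of itself extends by `q - 1` linear columns (`separating_productColumns`).
These `q + 3` columns give `q + 1` MOLS of order `q ^ 2`; fixing a cell in the second factor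
recovers the words. -/

/-- A family of columns `c i : Z → X` is separating if any two of the columns together determine
the point of `Z`. -/
def Separating {ι Z X : Type*} (c : ι → Z → X) : Prop :=
  ∀ i j, i ≠ j → ∀ z z', c i z = c i z' → c j z = c j z' → z = z'

/-! ### The linear array over `𝔽₄` and its corrections. -/

/-- Vectors of length four over the field with two elements. -/
abbrev Vec : Type := ZMod 2 × ZMod 2 × ZMod 2 × ZMod 2

/-- One bit of each of the four coordinates of a word, and a control bit. -/
abbrev Bits : Type := ZMod 2 × ZMod 2 × ZMod 2 × ZMod 2 × ZMod 2

namespace Vec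

/-- Multiplication by a primitive cube root of unity on `𝔽₄ × 𝔽₄`. -/
def omega (v : Vec) : Vec := (v.2.1, v.1 + v.2.1, v.2.2.2, v.2.2.1 + v.2.2.2)

/-- The four columns of a linear orthogonal array. -/
def col (i : Fin 4) (z : Vec × Vec) : Vec :=
  match i with
  | 0 => z.1
  | 1 => z.2
  | 2 => z.1 + z.2
  | 3 => z.1 + omega z.2

/-- The coordinates of a word without the control bit. -/
def coord (i : Fin 4) (w : Bits) : ZMod 2 :=
  match i with
  | 0 => w.1
  | 1 => w.2.1
  | 2 => w.2.2.1
  | 3 => w.2.2.2.1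

/-- The entry that the `i`-th column should have at the cell of a word: it depends on the `i`-th
coordinate `b` and the control bit `ε` only. -/
def target (i : Fin 4) (b ε : ZMod 2) : Vec :=
  match i with
  | 0 => (b, 0, 0, 0)
  | 1 => (0, b, 0, 0)
  | 2 => (0, 0, b, ε)
  | 3 => (ε, 0, 0, b)

/-- The cell of a word. -/
def base (w : Bits) : Vec × Vec := (target 0 w.1 w.2.2.2.2, target 1 w.2.1 w.2.2.2.2)

/-- The correction to be added to the `i`-th linear column at the cell of a word. -/
def corr (i : Fin 4) (w : Bits) : Vec := target i (coord i w) w.2.2.2.2 + col i (base w)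

/-- The translations of the block of a word. -/
def shift (w t : Bits) : Vec × Vec :=
  (t.1 • corr 2 w + t.2.2.1 • corr 3 w
      + t.2.2.2.2 • (corr 2 w + omega (corr 2 w + corr 3 w)),
    t.2.1 • corr 2 w + t.2.2.2.1 • omega (omega (corr 3 w))
      + t.2.2.2.2 • omega (corr 2 w + corr 3 w))

/-- The cells of the block of a word. -/
def cell (w t : Bits) : Vec × Vec := base w + shift w t

/-- The translation that realizes the corrections in the columns `i` and `j`. -/
def move (i j : Fin 4) : Bits :=
  match i, j with
  | 0, 2 => (0, 1, 0, 0, 0)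
  | 2, 0 => (0, 1, 0, 0, 0)
  | 1, 2 => (1, 0, 0, 0, 0)
  | 2, 1 => (1, 0, 0, 0, 0)
  | 1, 3 => (0, 0, 1, 0, 0)
  | 3, 1 => (0, 0, 1, 0, 0)
  | 0, 3 => (0, 0, 0, 1, 0)
  | 3, 0 => (0, 0, 0, 1, 0)
  | 2, 3 => (0, 0, 0, 0, 1)
  | 3, 2 => (0, 0, 0, 0, 1)
  | _, _ => 0

theorem omega_add (u v : Vec) : omega (u + v) = omega u + omega v := by
  simp only [omega, Prod.fst_add, Prod.snd_add, Prod.mk_add_mk, Prod.mk.injEq]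
  refine ⟨trivial, by ring, trivial, by ring⟩

theorem col_add (i : Fin 4) (u v : Vec × Vec) : col i (u + v) = col i u + col i v := by
  fin_cases i <;> simp only [col, Prod.fst_add, Prod.snd_add, omega_add] <;> abel

theorem cell_add_right (w t s : Bits) : cell w (t + s) = cell w t + shift w s := by
  simp only [cell, shift, Prod.fst_add, Prod.snd_add, add_smul, add_assoc, Prod.mk_add_mk]
  congr 2 <;> abel

theorem target_add (i : Fin 4) (b c d e : ZMod 2) :
    target i (b + c) (d + e) = target i b d + target i c e := by
  fin_cases i <;> simp [target]

theorem base_add (w v : Bits) : base (w + v) = base w + base v := by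
  simp [base, target_add]

theorem coord_add (i : Fin 4) (w v : Bits) : coord i (w + v) = coord i w + coord i v := by
  fin_cases i <;> rfl

theorem corr_add (i : Fin 4) (w v : Bits) : corr i (w + v) = corr i w + corr i v := by
  simp only [corr, coord_add, Prod.snd_add, target_add, base_add, col_add]
  abel

theorem cell_add_left (w v t : Bits) : cell (w + v) t = cell w t + cell v t := by
  simp only [cell, shift, base_add, corr_add, omega_add, smul_add]
  ext1
  · simp only [Prod.fst_add]; abel
  · simp only [Prod.snd_add]; abel

set_option synthInstance.maxSize 1000 in
set_option synthInstance.maxHeartbeats 200000 in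
set_option maxRecDepth 100000 in
-- The columns have `𝔽₄`-coefficients `(1, 0)`, `(0, 1)`, `(1, 1)`, `(1, ω)`, which are pairwise
-- independent.
theorem col_separating_zero : ∀ i j : Fin 4, i ≠ j → ∀ z : Vec × Vec,
    col i z = 0 → col j z = 0 → z = 0 := by
  decide

theorem col_separating : Separating col := by
  intro i j h z z' hi hj
  have key : ∀ k, col k z = col k z' → col k (z - z') = 0 := by
    intro k hk
    have := col_add k (z - z') z'
    rw [sub_add_cancel, hk] at this
    simpa using this
  exact sub_eq_zero.mp (col_separating_zero i j h _ (key i hi) (key j hj))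

/-- In characteristic 2, corrections 0 and 1 vanish. Each `move` solves two linear equations; the
pair `{2, 3}` uses `ω + ω ^ 2 = 1`. -/
theorem col_shift_move : ∀ i j : Fin 4, i ≠ j → ∀ w : Bits,
    col i (shift w (move i j)) = corr i w ∧ col j (shift w (move i j)) = corr j w := by
  decide

/-- Here corrections 2 and 3 are `(0, 0, 0, 1)` and `(1, 0, 0, 0)`, independent over `𝔽₄`, so the
control position reveals the translation. -/
theorem cell_control_zero : ∀ t : Bits, shift (0, 0, 0, 0, 1) t = 0 → t = 0 := by
  decide

theorem cell_control_injective : Function.Injective (cell (0, 0, 0, 0, 1)) := by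
  intro t s h
  have h1 := cell_add_right (0, 0, 0, 0, 1) s (t - s)
  rw [add_sub_cancel, h] at h1
  exact sub_eq_zero.mp (cell_control_zero _ (by simpa using h1))

set_option synthInstance.maxSize 1000 in
set_option synthInstance.maxHeartbeats 200000 in
-- By linearity in the word, equal cells with the same translation force agreement in two
-- coordinates. The pair depends on `t` alone, hence is the same at all positions of a word.
theorem cell_coord_zero : ∀ t : Bits, ∃ i j : Fin 4, i ≠ j ∧ ∀ a b c d : ZMod 2,
    cell (a, b, c, d, 0) t = 0 →
      coord i (a, b, c, d, 0) = 0 ∧ coord j (a, b, c, d, 0) = 0 := by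
  decide

theorem corr_col_base (i : Fin 4) (w : Bits) :
    col i (base w) + corr i w = target i (coord i w) w.2.2.2.2 := by
  have : ∀ v : Vec, v + v = 0 := by decide
  rw [corr, add_left_comm, this, add_zero]

theorem target_injective : ∀ i ε, Function.Injective fun b => target i b ε := by
  decide

end Vec

/-! ### Corrections on disjoint blocks. -/

/-- If the cells `f (s, t)` are distinct, then the translations by `u` within the blocks
`{f (s, t) | t : T}` and the identity elsewhere form a permutation of the cells. -/
noncomputable def blockShift {S T Z : Type*} [AddGroup T] (f : S × T → Z)
    (hf : Function.Injective f) (u : T) : Equiv.Perm Z :=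
  open Classical in
  Equiv.Perm.extendDomain (Equiv.prodCongr (Equiv.refl S) (Equiv.addRight u))
    (Equiv.ofInjective f hf)

theorem blockShift_apply {S T Z : Type*} [AddGroup T] (f : S × T → Z)
    (hf : Function.Injective f) (u : T) (s : S) (t : T) :
    blockShift f hf u (f (s, t)) = f (s, t + u) := by
  classical
  exact Equiv.Perm.extendDomain_apply_image _ (Equiv.ofInjective f hf) (s, t)

theorem blockShift_apply_of_notMem {S T Z : Type*} [AddGroup T] (f : S × T → Z)
    (hf : Function.Injective f) (u : T) {z : Z} (hz : z ∉ Set.range f) :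
    blockShift f hf u z = z := by
  classical
  exact Equiv.Perm.extendDomain_apply_not_subtype _ _ hz

/-- Corrections of separating columns that are constant on disjoint blocks, and that any two columns
can realize by a translation within the blocks, lead to separating columns. -/
theorem exists_separating_correction {ι S T Z X : Type*} [AddGroup T] [AddGroup X]
    (c : ι → Z → X) (hc : Separating c) (f : S × T → Z) (hf : Function.Injective f)
    (d : ι → S → X) (u : ι → ι → T)
    (hu : ∀ i j, i ≠ j → ∀ s t, c i (f (s, t + u i j)) = c i (f (s, t)) + d i s ∧
      c j (f (s, t + u i j)) = c j (f (s, t)) + d j s) :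
    ∃ c' : ι → Z → X, Separating c' ∧ ∀ i s t, c' i (f (s, t)) = c i (f (s, t)) + d i s := by
  classical
  let c' : ι → Z → X := fun i z => if h : ∃ p, f p = z then c i z + d i h.choose.1 else c i z
  have hin : ∀ i s t, c' i (f (s, t)) = c i (f (s, t)) + d i s := by
    intro i s t
    have h : ∃ p, f p = f (s, t) := ⟨_, rfl⟩
    simp only [c', dif_pos h, hf h.choose_spec]
  refine ⟨c', fun i j hij z z' hi hj => ?_, hin⟩
  -- The permutation depends on the pair `i, j`, but the corrected columns do not.
  have key : ∀ z, c' i z = c i (blockShift f hf (u i j) z) ∧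
      c' j z = c j (blockShift f hf (u i j) z) := by
    intro z
    by_cases h : ∃ p, f p = z
    · obtain ⟨⟨s, t⟩, rfl⟩ := h
      rw [hin, hin, blockShift_apply]
      exact ⟨(hu i j hij s t).1.symm, (hu i j hij s t).2.symm⟩
    · rw [blockShift_apply_of_notMem f hf _ h]
      simp only [c', dif_neg h, and_self]
  rw [(key z).1, (key z').1] at hi
  rw [(key z).2, (key z').2] at hj
  exact (blockShift f hf (u i j)).injective (hc i j hij _ _ hi hj)

/-! ### Embedding words in an orthogonal array. -/

/-- Words of length four that agree pairwise in at most one coordinate embed in an orthogonal array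
with four columns. -/
theorem exists_separating_of_words (n a : ℕ) (hn : n ≤ 2 ^ a) (S : Set (Fin 4 → Fin n))
    (hS : ∀ s ∈ S, ∀ s' ∈ S, ∀ i j, i ≠ j → s i = s' i → s j = s' j → s = s') :
    ∃ (c : Fin 4 → (Option (Fin a) → Vec × Vec) → Option (Fin a) → Vec)
      (h : Fin 4 → Fin n → Option (Fin a) → Vec),
      Separating c ∧ (∀ i, Function.Injective (h i)) ∧ ∀ s ∈ S, ∃ z, ∀ i, c i z = h i (s i) := by
  obtain ⟨ρ⟩ : Nonempty (Fin n ↪ (Fin a → ZMod 2)) :=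
    Function.Embedding.nonempty_of_card_le (by simpa [ZMod.card] using hn)
  -- Position `none` is the control: every word has bits 0 and control bit 1 there. The other
  -- positions hold binary digits, with control bit 0.
  let bit : Option (Fin a) → Fin n → ZMod 2 := fun k x => k.elim 0 (ρ x)
  let ε : Option (Fin a) → ZMod 2 := fun k => k.elim 1 fun _ => 0
  let w : S → Option (Fin a) → Bits := fun s k =>
    (bit k (s.1 0), bit k (s.1 1), bit k (s.1 2), bit k (s.1 3), ε k)
  have hcoord : ∀ s k i, Vec.coord i (w s k) = bit k (s.1 i) := by
    intro s k i
    fin_cases i <;> rfl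
  have hbit : ∀ x y, (∀ k, bit (some k) x = bit (some k) y) → x = y :=
    fun x y hxy => ρ.injective (funext hxy)
  let f : S × Bits → Option (Fin a) → Vec × Vec := fun p k => Vec.cell (w p.1 k) p.2
  have hf : Function.Injective f := by
    rintro ⟨s, t⟩ ⟨s', t'⟩ h
    obtain rfl : t = t' := Vec.cell_control_injective (congrFun h none)
    obtain ⟨i, j, hij, H⟩ := Vec.cell_coord_zero t
    have key : ∀ k, Vec.coord i (w s (some k)) = Vec.coord i (w s' (some k)) ∧
        Vec.coord j (w s (some k)) = Vec.coord j (w s' (some k)) := by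
      intro k
      have hk : Vec.cell (w s (some k)) t = Vec.cell (w s' (some k)) t := congrFun h (some k)
      have h1 := Vec.cell_add_left (w s (some k) - w s' (some k)) (w s' (some k)) t
      have h2 : ∀ i, Vec.coord i (w s (some k)) =
          Vec.coord i (w s (some k) - w s' (some k)) + Vec.coord i (w s' (some k)) := by
        intro i
        rw [← Vec.coord_add, sub_add_cancel]
      rw [sub_add_cancel, hk, right_eq_add] at h1
      have h3 : Vec.coord i (w s (some k) - w s' (some k)) = 0 ∧
          Vec.coord j (w s (some k) - w s' (some k)) = 0 := H _ _ _ _ h1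
      rw [h2 i, h2 j, h3.1, h3.2, zero_add, zero_add]
      exact ⟨rfl, rfl⟩
    simp only [hcoord] at key
    have := hS _ s.2 _ s'.2 i j hij (hbit _ _ fun k => (key k).1) (hbit _ _ fun k => (key k).2)
    rw [Subtype.ext this]
  let c : Fin 4 → (Option (Fin a) → Vec × Vec) → Option (Fin a) → Vec :=
    fun i z k => Vec.col i (z k)
  have hc : Separating c := fun i j hij z z' hi hj =>
    funext fun k => Vec.col_separating i j hij _ _ (congrFun hi k) (congrFun hj k)
  obtain ⟨c', hc', hcf⟩ := exists_separating_correction c hc f hf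
    (fun i s k => Vec.corr i (w s k)) Vec.move (by
      intro i j hij s t
      constructor <;> funext k <;>
        simp only [c, f, Pi.add_apply, Vec.cell_add_right, Vec.col_add,
          Vec.col_shift_move i j hij])
  refine ⟨c', fun i x k => Vec.target i (bit k x) (ε k), hc', fun i x y hxy => ?_,
    fun s hs => ⟨f (⟨s, hs⟩, 0), fun i => ?_⟩⟩
  · exact hbit _ _ fun k => Vec.target_injective i _ (congrFun hxy (some k))
  · rw [hcf]
    funext k
    have h0 : Vec.cell (w ⟨s, hs⟩ k) 0 = Vec.base (w ⟨s, hs⟩ k) := by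
      simp [Vec.cell, Vec.shift]
    simp only [c, f, Pi.add_apply, h0]
    rw [Vec.corr_col_base, hcoord]

/-! ### From separating columns to MOLS. -/

/-- Pairwise separating columns, two of which are used as rows and columns, form a set of MOLS. -/
theorem isMOLS_of_separating {ι Z : Type*} {m t : ℕ} [Fintype Z] (hm : 2 ≤ m)
    (hZ : Fintype.card Z = m ^ 2) (c : Option (Option ι) → Z → Fin m) (hc : Separating c)
    (g : Fin t → ι) (hg : Function.Injective g) :
    IsMOLS fun k : Fin t =>
      Set.range fun z => (c none z, c (some none) z, c (some (some (g k))) z) := by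
  have h01 := hc none (some none) (by simp)
  have h0 : ∀ k, ∀ z z', _ := fun k => hc none (some (some (g k))) (by simp)
  have h1 : ∀ k, ∀ z z', _ := fun k => hc (some none) (some (some (g k))) (by simp)
  have hkl : ∀ k l, k ≠ l → ∀ z z', _ := fun k l hkl =>
    hc (some (some (g k))) (some (some (g l))) (by simpa using hg.ne hkl)
  have hinj : ∀ k, Function.Injective fun z =>
      (c none z, c (some none) z, c (some (some (g k))) z) := by
    intro k z z' h
    simp only [Prod.mk.injEq] at h
    exact h01 _ _ h.1 h.2.1
  have hne : Nonempty Z := Fintype.card_pos_iff.mp (hZ ▸ by positivity)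
  refine ⟨fun k l h => ?_, fun k => ⟨⟨Set.range_nonempty _, ?_⟩, ?_⟩, fun k l hne => ⟨?_, ?_⟩⟩
  · by_contra hne
    have hz : ∀ z, c (some (some (g k))) z = c (some (some (g l))) z := by
      intro z
      have hmem : (c none z, c (some none) z, c (some (some (g k))) z) ∈
          Set.range fun z => (c none z, c (some none) z, c (some (some (g l))) z) := by
        rw [← show _ = Set.range fun z => (c none z, c (some none) z, c (some (some (g l))) z)
          from h]
        exact ⟨z, rfl⟩
      obtain ⟨z', hz'⟩ := hmem
      simp only [Prod.mk.injEq] at hz'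
      obtain rfl := h01 _ _ hz'.1 hz'.2.1
      exact hz'.2.2.symm
    -- A column separating together with itself would be injective, giving `m ^ 2 ≤ m`.
    have hle := Fintype.card_le_of_injective (c (some (some (g k)))) fun z z' e =>
      hkl k l hne z z' e (by rw [← hz, ← hz, e])
    rw [hZ, Fintype.card_fin] at hle
    nlinarith
  · rintro _ _ _ _ _ _ ⟨z, hz⟩ ⟨z', hz'⟩
    simp only [Prod.mk.injEq] at hz hz'
    obtain ⟨rfl, rfl, rfl⟩ := hz
    obtain ⟨rfl, rfl, rfl⟩ := hz'
    exact ⟨fun a b => by rw [h01 _ _ a b], fun a b => by rw [h0 _ _ _ a b],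
      fun a b => by rw [h1 _ _ _ a b]⟩
  · beta_reduce
    rw [← Set.image_univ, Set.ncard_image_of_injective _ (hinj k), Set.ncard_univ,
      Nat.card_eq_fintype_card, hZ]
  · intro r s
    constructor <;> rintro ⟨_, z, hz⟩ <;> simp only [Prod.mk.injEq] at hz <;>
      exact ⟨_, z, Prod.ext hz.1 (Prod.ext hz.2.1 rfl)⟩
  · rintro _ _ _ _ _ _ hcell ⟨z, hz⟩ ⟨z', hz'⟩ ⟨⟨y, hy⟩, ⟨y', hy'⟩⟩
    simp only [Prod.mk.injEq] at hz hz' hy hy'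
    obtain rfl := h01 z y (hz.1.trans hy.1.symm) (hz.2.1.trans hy.2.1.symm)
    obtain rfl := h01 z' y' (hz'.1.trans hy'.1.symm) (hz'.2.1.trans hy'.2.1.symm)
    obtain rfl := hkl k l hne z z' (hz.2.2.trans hz'.2.2.symm) (hy.2.2.trans hy'.2.2.symm)
    exact hcell (by rw [← hz.1, ← hz.2.1, ← hz'.1, ← hz'.2.1])

/-! ### The product array with additional columns. -/

/-- From four separating columns with entries in a field `F`, the rows, columns and symbols of
`|F| + 1` MOLS of order `|F| ^ 2`. -/
def productColumns {Z F : Type*} [Field F] (c : Fin 4 → Z → F) :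
    Option (Option (Option (Option Fˣ))) → Z × Z → F × F
  | none, p => (c 0 p.1, c 3 p.2)
  | some none, p => (c 1 p.1, c 2 p.2)
  | some (some none), p => (c 2 p.1, c 0 p.2)
  | some (some (some none)), p => (c 3 p.1, c 1 p.2)
  | some (some (some (some l))), p => (c 0 p.1 + l * c 0 p.2, c 1 p.1 + l * c 1 p.2)

theorem separating_productColumns {Z F : Type*} [Field F] (c : Fin 4 → Z → F)
    (hc : Separating c) : Separating (productColumns c) := by
  have swap : ∀ i j, (∀ z z', productColumns c i z = productColumns c i z' →
      productColumns c j z = productColumns c j z' → z = z') →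
      ∀ z z', productColumns c j z = productColumns c j z' →
      productColumns c i z = productColumns c i z' → z = z' :=
    fun i j h z z' hj hi => h z z' hi hj
  have pair : ∀ (i j k l : Fin 4), i ≠ j → k ≠ l → ∀ z z' : Z × Z,
      (c i z.1, c k z.2) = (c i z'.1, c k z'.2) → (c j z.1, c l z.2) = (c j z'.1, c l z'.2) →
      z = z' := by
    intro i j k l hij hkl z z' h h'
    simp only [Prod.mk.injEq] at h h'
    exact Prod.ext (hc i j hij _ _ h.1 h'.1) (hc k l hkl _ _ h.2 h'.2)
  have lin : ∀ (l : Fˣ) (i : Fin 4) (z z' : Z × Z), i = 0 ∨ i = 1 →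
      productColumns c (some (some (some (some l)))) z =
        productColumns c (some (some (some (some l)))) z' →
      (c i z.1 = c i z'.1 ↔ c i z.2 = c i z'.2) := by
    intro l i z z' hi h
    simp only [productColumns, Prod.mk.injEq] at h
    have : c i z.1 + l * c i z.2 = c i z'.1 + l * c i z'.2 := by
      rcases hi with rfl | rfl
      exacts [h.1, h.2]
    constructor <;> intro e <;> rw [e] at this
    · simpa using this
    · simpa using this
  -- Each product column contains exactly one of `c 0`, `c 1`. By `lin`, agreement there carries
  -- over to the other factor, where it meets a different column.
  have special : ∀ (l : Fˣ) (j : Option (Option (Option (Option Fˣ)))),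
      (∀ l', j ≠ some (some (some (some l')))) → ∀ z z',
      productColumns c (some (some (some (some l)))) z =
        productColumns c (some (some (some (some l)))) z' →
      productColumns c j z = productColumns c j z' → z = z' := by
    intro l j hj z z' h h'
    have h0 := lin l 0 z z' (Or.inl rfl) h
    have h1 := lin l 1 z z' (Or.inr rfl) h
    match j, hj with
    | none, _ =>
      simp only [productColumns, Prod.mk.injEq] at h'
      have e := hc 0 3 (by decide) _ _ (h0.mp h'.1) h'.2
      exact Prod.ext (hc 0 1 (by decide) _ _ h'.1 (h1.mpr (by rw [e]))) e
    | some none, _ =>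
      simp only [productColumns, Prod.mk.injEq] at h'
      have e := hc 1 2 (by decide) _ _ (h1.mp h'.1) h'.2
      exact Prod.ext (hc 0 1 (by decide) _ _ (h0.mpr (by rw [e])) h'.1) e
    | some (some none), _ =>
      simp only [productColumns, Prod.mk.injEq] at h'
      have e := hc 0 2 (by decide) _ _ (h0.mpr h'.2) h'.1
      exact Prod.ext e (hc 0 1 (by decide) _ _ h'.2 (h1.mp (by rw [e])))
    | some (some (some none)), _ =>
      simp only [productColumns, Prod.mk.injEq] at h'
      have e := hc 1 3 (by decide) _ _ (h1.mpr h'.2) h'.1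
      exact Prod.ext e (hc 0 1 (by decide) _ _ (h0.mp (by rw [e])) h'.2)
    | some (some (some (some l'))), hj => exact absurd rfl (hj l')
  intro i j hij
  match i, j, hij with
  | some (some (some (some l))), some (some (some (some l'))), hij =>
    intro z z' h h'
    have hl : (l : F) - l' ≠ 0 := sub_ne_zero.mpr fun e => hij (by rw [Units.ext e])
    have key : ∀ x y x' y' : F, x + l * y = x' + l * y' → x + l' * y = x' + l' * y' → y = y' := by
      intro x y x' y' e e'
      apply mul_left_cancel₀ hl
      linear_combination e - e'
    have h0 := lin l 0 z z' (Or.inl rfl) h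
    have h1 := lin l 1 z z' (Or.inr rfl) h
    simp only [productColumns, Prod.mk.injEq] at h h'
    have e0 := key _ _ _ _ h.1 h'.1
    have e1 := key _ _ _ _ h.2 h'.2
    exact Prod.ext (hc 0 1 (by decide) _ _ (h0.mpr e0) (h1.mpr e1))
      (hc 0 1 (by decide) _ _ e0 e1)
  | some (some (some (some l))), none, _ => exact special l _ (by simp)
  | some (some (some (some l))), some none, _ => exact special l _ (by simp)
  | some (some (some (some l))), some (some none), _ => exact special l _ (by simp)
  | some (some (some (some l))), some (some (some none)), _ => exact special l _ (by simp)
  | none, some (some (some (some l))), _ => exact swap _ _ (special l _ (by simp))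
  | some none, some (some (some (some l))), _ => exact swap _ _ (special l _ (by simp))
  | some (some none), some (some (some (some l))), _ => exact swap _ _ (special l _ (by simp))
  | some (some (some none)), some (some (some (some l))), _ =>
    exact swap _ _ (special l _ (by simp))
  | none, none, hij => exact absurd rfl hij
  | some none, some none, hij => exact absurd rfl hij
  | some (some none), some (some none), hij => exact absurd rfl hij
  | some (some (some none)), some (some (some none)), hij => exact absurd rfl hij
  | none, some none, _ => exact pair 0 1 3 2 (by decide) (by decide)
  | none, some (some none), _ => exact pair 0 2 3 0 (by decide) (by decide)
  | none, some (some (some none)), _ => exact pair 0 3 3 1 (by decide) (by decide)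
  | some none, none, _ => exact pair 1 0 2 3 (by decide) (by decide)
  | some none, some (some none), _ => exact pair 1 2 2 0 (by decide) (by decide)
  | some none, some (some (some none)), _ => exact pair 1 3 2 1 (by decide) (by decide)
  | some (some none), none, _ => exact pair 2 0 0 3 (by decide) (by decide)
  | some (some none), some none, _ => exact pair 2 1 0 2 (by decide) (by decide)
  | some (some none), some (some (some none)), _ => exact pair 2 3 0 1 (by decide) (by decide)
  | some (some (some none)), none, _ => exact pair 3 0 1 3 (by decide) (by decide)
  | some (some (some none)), some none, _ => exact pair 3 1 1 2 (by decide) (by decide)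
  | some (some (some none)), some (some none), _ => exact pair 3 2 1 0 (by decide) (by decide)

/-! ### Embedding orthogonal partial Latin squares. -/

theorem IsOPLS.word_eq {n : ℕ} {P Q : Set (Fin n × Fin n × Fin n)} (h : IsOPLS P Q)
    (s s' : Fin 4 → Fin n) (hP : (s 0, s 1, s 2) ∈ P) (hQ : (s 0, s 1, s 3) ∈ Q)
    (hP' : (s' 0, s' 1, s' 2) ∈ P) (hQ' : (s' 0, s' 1, s' 3) ∈ Q) (i j : Fin 4) (hij : i ≠ j)
    (hi : s i = s' i) (hj : s j = s' j) : s = s' := by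
  obtain ⟨a1, a2, a3⟩ := h.1.2 _ _ _ _ _ _ hP hP'
  obtain ⟨b1, b2, b3⟩ := h.2.1.2 _ _ _ _ _ _ hQ hQ'
  have hcell : s 0 = s' 0 ∧ s 1 = s' 1 := by
    by_contra hne
    have ho := h.2.2.2 (s 0) (s 1) (s' 0) (s' 1) (s 2) (s 3)
      (by simpa only [ne_eq, Prod.mk.injEq] using hne) hP
    fin_cases i <;> fin_cases j <;> simp only [Fin.isValue, Fin.zero_eta, Fin.mk_one,
      Fin.reduceFinMk] at hi hj hij
    all_goals first
      | exact absurd rfl hij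
      | exact hne ⟨hi, hj⟩
      | exact hne ⟨hj, hi⟩
      | exact hne ⟨hi, a2 hi hj⟩
      | exact hne ⟨hj, a2 hj hi⟩
      | exact hne ⟨hi, b2 hi hj⟩
      | exact hne ⟨hj, b2 hj hi⟩
      | exact hne ⟨a3 hi hj, hi⟩
      | exact hne ⟨a3 hj hi, hj⟩
      | exact hne ⟨b3 hi hj, hi⟩
      | exact hne ⟨b3 hj hi, hj⟩
      | exact ho (hi ▸ hP') ⟨hQ, hj ▸ hQ'⟩
      | exact ho (hj ▸ hP') ⟨hQ, hi ▸ hQ'⟩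
  funext k
  fin_cases k
  exacts [hcell.1, hcell.2, a1 hcell.1 hcell.2, b1 hcell.1 hcell.2]

theorem IsOPLS.embedsInMOLS {n a t : ℕ} (hn : n ≤ 2 ^ a) (ht : 2 ≤ t)
    (hta : t ≤ (2 ^ (a + 1)) ^ 4 + 1) {P Q : Set (Fin n × Fin n × Fin n)} (h : IsOPLS P Q) :
    EmbedsInMOLS P Q t ((2 ^ (a + 1)) ^ 8) := by
  classical
  let S : Set (Fin 4 → Fin n) := {s | (s 0, s 1, s 2) ∈ P ∧ (s 0, s 1, s 3) ∈ Q}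
  obtain ⟨c, x, hc, hx, hcx⟩ := exists_separating_of_words n a hn S
    fun s hs s' hs' => h.word_eq s s' hs.1 hs.2 hs'.1 hs'.2
  let F := GaloisField 2 (4 * (a + 1))
  let _ : Fintype F := Fintype.ofFinite F
  have hF : Fintype.card F = (2 ^ (a + 1)) ^ 4 := by
    rw [← Nat.card_eq_fintype_card, GaloisField.card _ _ (by positivity)]
    ring
  have hV : Fintype.card (Option (Fin a) → Vec) = Fintype.card F := by
    rw [hF]
    simp only [Vec, Fintype.card_fun, Fintype.card_prod, ZMod.card, Fintype.card_option,
      Fintype.card_fin, ← pow_mul]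
    rw [mul_comm (a + 1), pow_mul]
    norm_num
  let e : (Option (Fin a) → Vec) ≃ F := Fintype.equivOfCardEq hV
  let Z := Option (Fin a) → Vec × Vec
  have hZ : Fintype.card Z = Fintype.card F ^ 2 := by
    rw [← hV]
    simp only [Z, Fintype.card_fun, Fintype.card_prod, ← sq, ← pow_mul, mul_comm]
  let e' : F × F ≃ Fin ((2 ^ (a + 1)) ^ 8) := Fintype.equivFinOfCardEq (by
    rw [Fintype.card_prod, hF]; ring)
  let c₁ : Fin 4 → Z → F := fun i z => e (c i z)
  have hc₁ : Separating c₁ := fun i j hij z z' hi hj =>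
    hc i j hij z z' (e.injective hi) (e.injective hj)
  have hc₂ := separating_productColumns c₁ hc₁
  have hc₃ : Separating fun i z => e' (productColumns c₁ i z) := fun i j hij z z' hi hj =>
    hc₂ i j hij z z' (e'.injective hi) (e'.injective hj)
  obtain ⟨t, rfl⟩ := Nat.exists_eq_add_of_le' ht
  obtain ⟨g⟩ : Nonempty (Fin t ↪ Fˣ) := Function.Embedding.nonempty_of_card_le (by
    rw [Fintype.card_units, hF, Fintype.card_fin]; omega)
  -- The first two squares take their symbols from product columns 2 and 3, which carry `P` and `Q`.
  let g' : Fin (t + 2) → Option (Option Fˣ) :=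
    Fin.cons none (Fin.cons (some none) fun i => some (some (g i)))
  have hg' : Function.Injective g' := by
    simp only [g', Fin.cons_injective_iff]
    refine ⟨?_, ?_, fun i j hij => g.injective (by simpa using hij)⟩
    · rintro ⟨i, hi⟩
      induction i using Fin.cases <;> simp at hi
    · rintro ⟨i, hi⟩
      simp at hi
  have hm : 2 ≤ (2 ^ (a + 1)) ^ 8 := by
    rw [← pow_mul]
    exact Nat.le_self_pow (by positivity) 2
  refine ⟨_, isMOLS_of_separating hm ?_ _ hc₃ g' hg', 0, 1, by simp, ?_⟩
  · rw [Fintype.card_prod, hZ, hF]; ring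
  let z₀ : Z := 0
  have inj₁ : ∀ (i : Fin 4) (b : F), Function.Injective fun r => e' (e (x i r), b) := by
    intro i b r r' hr
    exact hx i (e.injective (Prod.mk.inj (e'.injective hr)).1)
  refine ⟨fun r => e' (e (x 0 r), c₁ 3 z₀), fun r => e' (e (x 1 r), c₁ 2 z₀),
    fun r => e' (e (x 2 r), c₁ 0 z₀), fun r => e' (e (x 3 r), c₁ 1 z₀),
    ⟨inj₁ _ _, inj₁ _ _, inj₁ _ _, fun r s y hP => ?_⟩,
    ⟨inj₁ _ _, inj₁ _ _, inj₁ _ _, fun r s y hQ => ?_⟩⟩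
  · obtain ⟨y', hQ⟩ := (h.2.2.1 r s).mp ⟨y, hP⟩
    obtain ⟨z, hz⟩ := hcx ![r, s, y, y'] ⟨hP, hQ⟩
    refine ⟨(z, z₀), ?_⟩
    simp [productColumns, c₁, hz, g']
  · obtain ⟨y', hP⟩ := (h.2.2.1 r s).mpr ⟨y, hQ⟩
    obtain ⟨z, hz⟩ := hcx ![r, s, y', y] ⟨hP, hQ⟩
    refine ⟨(z, z₀), ?_⟩
    have h1 : g' 1 = some none := rfl
    simp [productColumns, c₁, hz, h1]

theorem mainTheorem4 (t : ℕ) (ht : 2 ≤ t) :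
    (∃ (p : Polynomial ℕ) (N : ℕ → ℕ), (∀ n : ℕ, N n ≤ p.eval n) ∧
      ∀ (n : ℕ) (P Q : Set (Fin n × Fin n × Fin n)), IsOPLS P Q → EmbedsInMOLS P Q t (N n)) ∧
    (∀ n k : ℕ, (∃ a : ℕ, k = 2 ^ a) → 2 * n ≤ k → k < 2 * (2 * n) → t ≤ k ^ 4 + 1 →
      ∀ P Q : Set (Fin n × Fin n × Fin n), IsOPLS P Q → EmbedsInMOLS P Q t (k ^ 8)) := by
  -- Rounding `n + t` up to a power of 2 meets the bounds on `n` and on `t` at once.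
  refine ⟨⟨(4 * (Polynomial.X + Polynomial.C t)) ^ 8,
    fun n => (2 ^ (Nat.clog 2 (n + t) + 1)) ^ 8, fun n => ?_, fun n P Q h => ?_⟩, ?_⟩
  · have hlt := Nat.pow_pred_clog_lt_self (b := 2) (by norm_num) (show 1 < n + t by omega)
    have hpos : 0 < Nat.clog 2 (n + t) := Nat.clog_pos (by norm_num) (by omega)
    obtain ⟨d, hd⟩ := Nat.exists_eq_succ_of_ne_zero hpos.ne'
    rw [hd, Nat.pred_succ] at hlt
    have hle : 2 ^ (d + 1 + 1) ≤ 4 * (n + t) := by rw [pow_succ, pow_succ]; omega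
    simpa [hd] using Nat.pow_le_pow_left hle 8
  · have hle : n + t ≤ 2 ^ Nat.clog 2 (n + t) := Nat.le_pow_clog (by norm_num) _
    refine h.embedsInMOLS (by omega) ht ?_
    calc t ≤ 2 ^ (Nat.clog 2 (n + t) + 1) := by rw [pow_succ]; omega
      _ ≤ (2 ^ (Nat.clog 2 (n + t) + 1)) ^ 4 := Nat.le_self_pow (by norm_num) _
      _ ≤ _ := Nat.le_succ _
  · rintro n _ ⟨a, rfl⟩ hn hlt hta P Q h
    -- `k = 1` would force `n = 0`, against `k < 4 * n`.
    rcases a with _ | a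
    · omega
    · exact h.embedsInMOLS (by rw [pow_succ] at hn; omega) ht hta
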